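/- Let $G$ be a finite group and $H\le G$ a subgroup. A $G$-Tambara functor $R$ assigns to each finite $G$-set $X$ a commutative ring $R(X)$ and to each $G$-map $f:X\to Y$ a ring homomorphism $\mathrm{Res}_f:R(Y)\to R(X)$, an additive map $\mathrm{Tr}_f:R(X)\to R(Y)$ and a multiplicative map $\mathrm{Nm}_f:R(X)\to R(Y)$, all functorial, such that finite disjoint unions are sent to products, $\mathrm{Tr}$ and $\mathrm{Nm}$ satisfy base change along pullback squares, and the distributive law $\mathrm{Nm}_f\mathrm{Tr}_p=\mathrm{Tr}_q\mathrm{Nm}_{f'}\mathrm{Res}_e$ holds for every exponential diagram $X\xleftarrow{p}A\xleftarrow{e}X\times_Y\Pi_fA\xrightarrow{f'}\Pi_fA\xrightarrow{q}Y$. For an $H$-Tambara functor $R$, the $G$-Tambara functor $\mathrm{CoInd}_H^GR$ is $X\mapsto R(X|_H)$, where $X|_H$ is the underlying $H$-set of $X$. A Tambara ideal $I$ of a $G$-Tambara functor $R$ is a family of ideals $I(G/K)\subseteq R(G/K)$, $K\le G$, closed under restriction, transfer and norm along all $G$-maps $G/K\to G/L$. Tambara ideals are ordered by levelwise containment; $I\cdot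 J$ is the Tambara ideal generated by all products $ab$ with $a\in I(G/K)$, $b\in J(G/K)$, $K\le G$; and $\mathfrak p$ is prime if it is proper and $I\cdot J\subseteq\mathfrak p$ implies $I\subseteq\mathfrak p$ or $J\subseteq\mathfrak p$. The Nakaoka spectrum $\mathrm{Spec}(R)$ is the set of prime ideals, with the topology generated by the closed sets $V(I)=\{\mathfrak p: I\subseteq\mathfrak p\}$. For a Tambara ideal $I$ of an $H$-Tambara functor $R$, let $(\mathrm{CoInd}_H^GI)(G/K)$ be the ideal of $(\mathrm{CoInd}_H^GR)(G/K)=R((G/K)|_H)$ of all $x$ with $\mathrm{Res}_f(x)\in I(H/L)$ for all $L\le H$ and all $H$-maps $f:H/L\to (G/K)|_H$; under the identification of $R((G/K)|_H)$ with the product of the rings $R(H/L_i)$ over the $H$-orbits $H/L_i$ of $G/K$, this is the product of the ideals $I(H/L_i)$. **Theorem.** For every $H$-Tambara functor $R$: 1. $I\mapsto\mathrm{CoInd}_H^GI$ is a bijection from the set of Tambara ideals of $R$ to the set of Tambara ideals of $\mathrm{CoInd}_H^GR$, which preserves and reflects containment and satisfies $\mathrm{CoInd}_H^G(I\cdot J)=\mathrm{CoInd}_H^GI\cdot\mathrm{CoInd}_H^GJ$.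 A Tambara ideal $\mathfrak p$ of $R$ is prime if and only if $\mathrm{CoInd}_H^G\mathfrak p$ is prime. 2. The inverse of this bijection restricts to a homeomorphism $\mathrm{Spec}(\mathrm{CoInd}_H^GR)\cong\mathrm{Spec}(R)$. It is natural in $R$: for a morphism $\varphi:R\to S$ of $H$-Tambara functors, $\mathfrak q\mapsto\varphi^{-1}\mathfrak q$ and $\mathfrak q\mapsto(\mathrm{CoInd}_H^G\varphi)^{-1}\mathfrak q$ are continuous maps $\mathrm{Spec}(S)\to\mathrm{Spec}(R)$ and $\mathrm{Spec}(\mathrm{CoInd}_H^GS)\to\mathrm{Spec}(\mathrm{CoInd}_H^GR)$, and they commute with the homeomorphisms for $R$ and $S$. -/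

import Mathlib

universe u v

/-- A finite `G`-set. -/
structure FinGSet (G : Type u) [Group G] where
  carrier : Type u
  [action : MulAction G carrier]
  [finite : Finite carrier]

attribute [instance] FinGSet.action FinGSet.finite

namespace FinGSet

instance {G : Type u} [Group G] : CoeSort (FinGSet G) (Type u) := ⟨FinGSet.carrier⟩

/-- The transitive `G`-set `G/K`. -/
def orbit {G : Type u} [Group G] [Finite G] (K : Subgroup G) : FinGSet G where
  carrier := G ⧸ K

/-- A `G`-set regarded as an `H`-set, for a subgroup `H` of `G`. -/
def restrict {G : Type u} [Group G] (H : Subgroup G) (X : FinGSet G) : FinGSet H where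
  carrier := X.carrier

/-- A `G`-map regarded as an `H`-map. -/
def restrictMap {G : Type u} [Group G] (H : Subgroup G) {X Y : FinGSet G} (f : X →[G] Y) :
    restrict H X →[H] restrict H Y where
  toFun := fun x => f x
  map_smul' := fun h x => f.map_smul (h : G) x

section
variable {G : Type u} [Group G]

/-- `Z` is the disjoint union of `X` and `Y` along `i` and `j`. -/
def IsCoproduct {X Y Z : FinGSet G} (i : X →[G] Z) (j : Y →[G] Z) : Prop :=
  Function.Bijective (Sum.elim (fun x => i x) (fun y => j y) : X ⊕ Y → Z)

/-- The square
```
P --q--> Y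
|p       |g
X --f--> Z
```
commutes and is a pullback. -/
def IsPullback {P X Y Z : FinGSet G} (p : P →[G] X) (q : P →[G] Y)
    (f : X →[G] Z) (g : Y →[G] Z) : Prop :=
  (∀ a, f (p a) = g (q a)) ∧ ∀ x y, f x = g y → ∃! a, p a = x ∧ q a = y

/-- The diagram
```
X <--p-- A <--e-- E
|f                |f'
Y <-------q------ P
```
is an exponential diagram: `E` is the pullback of `f` and `q`, and the points of `P` over `y`
correspond, via evaluation `e`, bijectively to the sections of `p` over the fibre `f⁻¹(y)`.
Equivalently, `P` is the dependent product of `A` along `f`. -/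
def IsExponential {X Y A E P : FinGSet G} (f : X →[G] Y) (p : A →[G] X) (e : E →[G] A)
    (f' : E →[G] P) (q : P →[G] Y) : Prop :=
  IsPullback (p.comp e) f' f q ∧
    ∀ (y : Y) (s : {x : X // f x = y} → A), (∀ x, p (s x) = x.1) →
      ∃! π : P, q π = y ∧
        ∀ ε : E, f' ε = π → ∀ h : f (p (e ε)) = y, e ε = s ⟨p (e ε), h⟩

end

end FinGSet

open FinGSet in
/-- A `G`-Tambara functor: a commutative ring `obj X` for each finite `G`-set `X`, with
restrictions, transfers (additive) and norms (multiplicative), such that disjoint unions go to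
products, and transfers and norms satisfy the base change formula and the distributive law. -/
structure TambaraFunctor (G : Type u) [Group G] where
  obj : FinGSet G → Type v
  [ring : ∀ X, CommRing (obj X)]
  res : ∀ {X Y : FinGSet G}, (X →[G] Y) → obj Y →+* obj X
  tr : ∀ {X Y : FinGSet G}, (X →[G] Y) → obj X →+ obj Y
  nm : ∀ {X Y : FinGSet G}, (X →[G] Y) → obj X →* obj Y
  res_id : ∀ (X : FinGSet G) (a : obj X), res (MulActionHom.id G) a = a
  tr_id : ∀ (X : FinGSet G) (a : obj X), tr (MulActionHom.id G) a = a
  nm_id : ∀ (X : FinGSet G) (a : obj X), nm (MulActionHom.id G) a = a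
  res_comp : ∀ {X Y Z : FinGSet G} (g : Y →[G] Z) (f : X →[G] Y) (a : obj Z),
    res (g.comp f) a = res f (res g a)
  tr_comp : ∀ {X Y Z : FinGSet G} (g : Y →[G] Z) (f : X →[G] Y) (a : obj X),
    tr (g.comp f) a = tr g (tr f a)
  nm_comp : ∀ {X Y Z : FinGSet G} (g : Y →[G] Z) (f : X →[G] Y) (a : obj X),
    nm (g.comp f) a = nm g (nm f a)
  subsingleton_obj : ∀ X : FinGSet G, IsEmpty X → Subsingleton (obj X)
  bijective_res : ∀ {X Y Z : FinGSet G} (i : X →[G] Z) (j : Y →[G] Z), IsCoproduct i j →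
    Function.Bijective (fun a : obj Z => (res i a, res j a))
  res_tr : ∀ {P X Y Z : FinGSet G} (p : P →[G] X) (q : P →[G] Y) (f : X →[G] Z) (g : Y →[G] Z),
    IsPullback p q f g → ∀ a : obj X, res g (tr f a) = tr q (res p a)
  res_nm : ∀ {P X Y Z : FinGSet G} (p : P →[G] X) (q : P →[G] Y) (f : X →[G] Z) (g : Y →[G] Z),
    IsPullback p q f g → ∀ a : obj X, res g (nm f a) = nm q (res p a)
  nm_tr : ∀ {X Y A E P : FinGSet G} (f : X →[G] Y) (p : A →[G] X) (e : E →[G] A)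
    (f' : E →[G] P) (q : P →[G] Y),
    IsExponential f p e f' q → ∀ a : obj A, nm f (tr p a) = tr q (nm f' (res e a))

attribute [instance] TambaraFunctor.ring

namespace TambaraFunctor

/-- A morphism of Tambara functors. -/
structure Hom {G : Type u} [Group G] (R S : TambaraFunctor.{u, v} G) where
  app : ∀ X : FinGSet G, R.obj X →+* S.obj X
  app_res : ∀ {X Y : FinGSet G} (f : X →[G] Y) (a : R.obj Y),
    app X (R.res f a) = S.res f (app Y a)
  app_tr : ∀ {X Y : FinGSet G} (f : X →[G] Y) (a : R.obj X),
    app Y (R.tr f a) = S.tr f (app X a)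
  app_nm : ∀ {X Y : FinGSet G} (f : X →[G] Y) (a : R.obj X),
    app Y (R.nm f a) = S.nm f (app X a)

/-- The coinduction of an `H`-Tambara functor: its value at a `G`-set `X` is the value of `R` at
the underlying `H`-set of `X`. -/
def coind {G : Type u} [Group G] (H : Subgroup G) (R : TambaraFunctor.{u, v} H) :
    TambaraFunctor.{u, v} G where
  obj X := R.obj (X.restrict H)
  res f := R.res (FinGSet.restrictMap H f)
  tr f := R.tr (FinGSet.restrictMap H f)
  nm f := R.nm (FinGSet.restrictMap H f)
  res_id X a := R.res_id (X.restrict H) a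
  tr_id X a := R.tr_id (X.restrict H) a
  nm_id X a := R.nm_id (X.restrict H) a
  res_comp g f a := R.res_comp (FinGSet.restrictMap H g) (FinGSet.restrictMap H f) a
  tr_comp g f a := R.tr_comp (FinGSet.restrictMap H g) (FinGSet.restrictMap H f) a
  nm_comp g f a := R.nm_comp (FinGSet.restrictMap H g) (FinGSet.restrictMap H f) a
  subsingleton_obj X hX := R.subsingleton_obj (X.restrict H) hX
  bijective_res i j h := R.bijective_res (FinGSet.restrictMap H i) (FinGSet.restrictMap H j) h
  res_tr p q f g h a := R.res_tr (FinGSet.restrictMap H p) (FinGSet.restrictMap H q)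
    (FinGSet.restrictMap H f) (FinGSet.restrictMap H g) h a
  res_nm p q f g h a := R.res_nm (FinGSet.restrictMap H p) (FinGSet.restrictMap H q)
    (FinGSet.restrictMap H f) (FinGSet.restrictMap H g) h a
  nm_tr f p e f' q h a := R.nm_tr (FinGSet.restrictMap H f) (FinGSet.restrictMap H p)
    (FinGSet.restrictMap H e) (FinGSet.restrictMap H f') (FinGSet.restrictMap H q) h a

/-- Coinduction on morphisms. -/
def Hom.coind {G : Type u} [Group G] (H : Subgroup G) {R S : TambaraFunctor.{u, v} H}
    (φ : Hom R S) : Hom (R.coind H) (S.coind H) where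
  app X := φ.app (X.restrict H)
  app_res f a := φ.app_res (FinGSet.restrictMap H f) a
  app_tr f a := φ.app_tr (FinGSet.restrictMap H f) a
  app_nm f a := φ.app_nm (FinGSet.restrictMap H f) a

end TambaraFunctor

open FinGSet in
/-- A Tambara ideal: an ideal of `R(G/K)` for every subgroup `K`, closed under restriction,
transfer and norm along all maps between the transitive `G`-sets `G/K`. Each such map is a
projection `G/K → G/L` with `K ≤ L` followed by a conjugation isomorphism. -/
@[ext]
structure TambaraIdeal {G : Type u} [Group G] [Finite G] (R : TambaraFunctor.{u, v} G) where
  level : ∀ K : Subgroup G, Ideal (R.obj (orbit K))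
  res_mem : ∀ {K L : Subgroup G} (f : orbit K →[G] orbit L) {a : R.obj (orbit L)},
    a ∈ level L → R.res f a ∈ level K
  tr_mem : ∀ {K L : Subgroup G} (f : orbit K →[G] orbit L) {a : R.obj (orbit K)},
    a ∈ level K → R.tr f a ∈ level L
  nm_mem : ∀ {K L : Subgroup G} (f : orbit K →[G] orbit L) {a : R.obj (orbit K)},
    a ∈ level K → R.nm f a ∈ level L

namespace TambaraIdeal

section
variable {G : Type u} [Group G] [Finite G] {R : TambaraFunctor.{u, v} G}

/-- Containment of Tambara ideals, level by level. -/
instance : PartialOrder (TambaraIdeal R) :=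
  PartialOrder.lift TambaraIdeal.level fun _ _ h => TambaraIdeal.ext h

/-- The intersection of a set of Tambara ideals. -/
instance : InfSet (TambaraIdeal R) where
  sInf S :=
    { level := fun K => ⨅ I ∈ S, I.level K
      res_mem := fun f a ha => by
        simp only [Submodule.mem_iInf] at ha ⊢
        exact fun I hI => I.res_mem f (ha I hI)
      tr_mem := fun f a ha => by
        simp only [Submodule.mem_iInf] at ha ⊢
        exact fun I hI => I.tr_mem f (ha I hI)
      nm_mem := fun f a ha => by
        simp only [Submodule.mem_iInf] at ha ⊢
        exact fun I hI => I.nm_mem f (ha I hI) }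

/-- The Tambara ideal generated by a family of sets of elements. -/
def span (s : ∀ K : Subgroup G, Set (R.obj (FinGSet.orbit K))) : TambaraIdeal R :=
  sInf {I | ∀ K, s K ⊆ I.level K}

/-- The product of Tambara ideals: the Tambara ideal generated by the levelwise products. -/
instance : Mul (TambaraIdeal R) where
  mul I J := span fun K => {c | ∃ a ∈ I.level K, ∃ b ∈ J.level K, c = a * b}

/-- Prime Tambara ideals (in particular, proper). -/
def IsPrime (p : TambaraIdeal R) : Prop :=
  (∃ K, p.level K ≠ ⊤) ∧ ∀ I J : TambaraIdeal R, I * J ≤ p → I ≤ p ∨ J ≤ p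

/-- The contraction of a Tambara ideal along a morphism. -/
def comap {S : TambaraFunctor.{u, v} G} (φ : R.Hom S) (J : TambaraIdeal S) : TambaraIdeal R where
  level K := (J.level K).comap (φ.app (FinGSet.orbit K))
  res_mem f a ha := by
    rw [Ideal.mem_comap] at ha ⊢
    rw [φ.app_res]
    exact J.res_mem f ha
  tr_mem f a ha := by
    rw [Ideal.mem_comap] at ha ⊢
    rw [φ.app_tr]
    exact J.tr_mem f ha
  nm_mem f a ha := by
    rw [Ideal.mem_comap] at ha ⊢
    rw [φ.app_nm]
    exact J.nm_mem f ha

/-- The value of a Tambara ideal at an arbitrary finite `G`-set `X`: the elements of `R(X)` whose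
restriction along every `G/L → X` lies in the ideal. If `X` is a disjoint union of orbits
`G/Lᵢ`, this is the product of the ideals at the `G/Lᵢ` inside `R(X) ≅ ∏ R(G/Lᵢ)`. -/
def value (I : TambaraIdeal R) (X : FinGSet G) : Ideal (R.obj X) :=
  ⨅ (L : Subgroup G) (f : FinGSet.orbit L →[G] X), (I.level L).comap (R.res f)

end

/-- The level `G/K` of the coinduction of a Tambara ideal `I` of an `H`-Tambara functor `R`:
the value of `I` at the underlying `H`-set of `G/K`, as an ideal of the ring
`(R.coind H).obj (G/K) = R.obj ((G/K).restrict H)`. -/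
def coindLevel {G : Type u} [Group G] [Finite G] (H : Subgroup G) {R : TambaraFunctor.{u, v} H}
    (I : TambaraIdeal R) (K : Subgroup G) : Ideal ((R.coind H).obj (FinGSet.orbit K)) :=
  I.value ((FinGSet.orbit K).restrict H)

end TambaraIdeal

/-- The Nakaoka spectrum of a Tambara functor: the set of its prime ideals. -/
def NakaokaSpectrum {G : Type u} [Group G] [Finite G] (R : TambaraFunctor.{u, v} G) :
    Type (max u v) :=
  {p : TambaraIdeal R // p.IsPrime}

namespace NakaokaSpectrum

/-- The underlying Tambara ideal of a point of the Nakaoka spectrum. -/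
def ideal {G : Type u} [Group G] [Finite G] {R : TambaraFunctor.{u, v} G}
    (p : NakaokaSpectrum R) : TambaraIdeal R :=
  p.1

/-- The set `V(I)` of prime ideals that contain `I`. -/
def zeroLocus {G : Type u} [Group G] [Finite G] {R : TambaraFunctor.{u, v} G}
    (I : TambaraIdeal R) : Set (NakaokaSpectrum R) :=
  {p | I ≤ p.ideal}

/-- The topology whose generating closed sets are the sets `V(I)`. -/
instance {G : Type u} [Group G] [Finite G] (R : TambaraFunctor.{u, v} G) :
    TopologicalSpace (NakaokaSpectrum R) :=
  TopologicalSpace.generateFrom {U | ∃ I : TambaraIdeal R, U = (zeroLocus I)ᶜ}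

end NakaokaSpectrum

/-! The `H`-set `H/L` sits inside `(G/L)|_H` as one orbit, via the injection `unit`. Transfer along
an injection is extension by zero and restriction along it is a left inverse, so `R(H/L)` is a
direct factor of `(CoInd R)(G/L)`. Hence `I` is recovered from `CoInd I`, and `descend J` consists
of the elements whose extension by zero lies in `J`. It is a Tambara ideal because an `H`-map `H/L →
H/M` is the pullback of the induced `G`-map `G/L → G/M` along `unit` (`isPullback_induce`). It is
inverse to coinduction because every orbit `H/L → (G/K)|_H` factors through `unit` and a `G`-map
`G/L → G/K` (`extend_comp_unit`).

Products are respected by Frobenius reciprocity (`tr_mul_res`), itself a case of the distributive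
law. Primality and the topology depend only on order and product, so they carry over.

Naturality also needs contraction to preserve primes and be continuous. Both follow from an explicit
extension of ideals, `map`, whose closure under norms is again the distributive law. -/

namespace FinGSet

/-! ### Finite `G`-sets: sums, fibre products, complements, dependent products, orbits. -/

section
variable {G : Type u} [Group G]

/-- The empty `G`-set. -/
def empty (G : Type u) [Group G] : FinGSet G where
  carrier := PEmpty
  action := { smul := fun _ x => x, one_smul := fun x => x.elim, mul_smul := fun _ _ x => x.elim }

/-- The unique `G`-map from the empty `G`-set. -/
def fromEmpty (X : FinGSet G) : empty G →[G] X where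
  toFun x := PEmpty.elim x
  map_smul' _ x := PEmpty.elim x

/-- The disjoint union of two finite `G`-sets. -/
def sum (X Y : FinGSet G) : FinGSet G where
  carrier := X ⊕ Y

/-- The left inclusion into a disjoint union. -/
def inl (X Y : FinGSet G) : X →[G] sum X Y where
  toFun := Sum.inl
  map_smul' _ _ := rfl

/-- The right inclusion into a disjoint union. -/
def inr (X Y : FinGSet G) : Y →[G] sum X Y where
  toFun := Sum.inr
  map_smul' _ _ := rfl

/-- The map out of a disjoint union given by a pair of maps. -/
def desc {X Y Z : FinGSet G} (f : X →[G] Z) (g : Y →[G] Z) : sum X Y →[G] Z where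
  toFun := Sum.elim f g
  map_smul' c x := by
    rcases x with x | x
    · exact f.map_smul c x
    · exact g.map_smul c x

/-- The fibre product of two finite `G`-sets. -/
def fiberProd {X Y Z : FinGSet G} (f : X →[G] Z) (g : Y →[G] Z) : FinGSet G where
  carrier := {a : X × Y // f a.1 = g a.2}
  action :=
    { smul := fun c a => ⟨c • a.1, by
        rw [Prod.smul_fst, Prod.smul_snd, map_smul, map_smul, a.2]⟩
      one_smul := fun a => Subtype.ext (one_smul G a.1)
      mul_smul := fun b c a => Subtype.ext (mul_smul b c a.1) }

/-- The first projection of a fibre product. -/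
def fst {X Y Z : FinGSet G} (f : X →[G] Z) (g : Y →[G] Z) : fiberProd f g →[G] X where
  toFun a := a.1.1
  map_smul' _ _ := rfl

/-- The second projection of a fibre product. -/
def snd {X Y Z : FinGSet G} (f : X →[G] Z) (g : Y →[G] Z) : fiberProd f g →[G] Y where
  toFun a := a.1.2
  map_smul' _ _ := rfl

theorem isPullback_fiberProd {X Y Z : FinGSet G} (f : X →[G] Z) (g : Y →[G] Z) :
    IsPullback (fst f g) (snd f g) f g :=
  ⟨fun a => a.2, fun x y h => ⟨⟨(x, y), h⟩, ⟨rfl, rfl⟩,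
    fun _ hb => Subtype.ext (Prod.ext hb.1 hb.2)⟩⟩

theorem IsPullback.surjective {P X Y Z : FinGSet G} {p : P →[G] X} {q : P →[G] Y}
    {f : X →[G] Z} {g : Y →[G] Z} (h : IsPullback p q f g) (hf : Function.Surjective f) :
    Function.Surjective q := fun y => by
  obtain ⟨x, hx⟩ := hf (g y)
  obtain ⟨a, ha, -⟩ := h.2 x y hx
  exact ⟨a, ha.2⟩

theorem isPullback_of_injective {X Z : FinGSet G} {i : X →[G] Z} (hi : Function.Injective i) :
    IsPullback (MulActionHom.id G) (MulActionHom.id G) i i :=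
  ⟨fun _ => rfl, fun x _ h => ⟨x, ⟨rfl, hi h⟩, fun _ hb => hb.1⟩⟩

theorem IsCoproduct.symm {X Y Z : FinGSet G} {i : X →[G] Z} {j : Y →[G] Z}
    (h : IsCoproduct i j) : IsCoproduct j i := by
  have : (Sum.elim (fun y => j y) (fun x => i x) : Y ⊕ X → Z) =
      (Sum.elim (fun x => i x) (fun y => j y) : X ⊕ Y → Z) ∘ Equiv.sumComm Y X := by
    ext (x | x) <;> rfl
  unfold IsCoproduct
  rw [this]
  exact Function.Bijective.comp h (Equiv.bijective _)

theorem IsCoproduct.injective_left {X Y Z : FinGSet G} {i : X →[G] Z} {j : Y →[G] Z}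
    (h : IsCoproduct i j) : Function.Injective i :=
  fun _ _ hab => Sum.inl_injective (h.1 hab)

theorem IsCoproduct.isPullback_empty {X Y Z : FinGSet G} {i : X →[G] Z} {j : Y →[G] Z}
    (h : IsCoproduct i j) : IsPullback (fromEmpty X) (fromEmpty Y) i j :=
  ⟨fun a => PEmpty.elim a, fun x y hxy => by
    have := @h.1 (Sum.inl x) (Sum.inr y) hxy
    cases this⟩

theorem isCoproduct_sum (X Y : FinGSet G) : IsCoproduct (inl X Y) (inr X Y) := by
  have : (Sum.elim (fun x => inl X Y x) (fun y => inr X Y y) : X ⊕ Y → X ⊕ Y) = id := by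
    ext (x | x) <;> rfl
  unfold IsCoproduct
  exact (congrArg Function.Bijective this).mpr Function.bijective_id

/-- The complement of the image of a `G`-map. -/
def compl {X Z : FinGSet G} (i : X →[G] Z) : FinGSet G where
  carrier := {z : Z // z ∉ Set.range i}
  action :=
    { smul := fun c a => ⟨c • a.1, by
        rintro ⟨x, hx⟩
        exact a.2 ⟨c⁻¹ • x, by rw [map_smul, hx, inv_smul_smul]⟩⟩
      one_smul := fun a => Subtype.ext (one_smul G a.1)
      mul_smul := fun b c a => Subtype.ext (mul_smul b c a.1) }

/-- The inclusion of the complement of the image of a `G`-map. -/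
def complIncl {X Z : FinGSet G} (i : X →[G] Z) : compl i →[G] Z where
  toFun a := a.1
  map_smul' _ _ := rfl

theorem isCoproduct_compl {X Z : FinGSet G} {i : X →[G] Z} (hi : Function.Injective i) :
    IsCoproduct i (complIncl i) := by
  constructor
  · rintro (x | x) (y | y) hxy
    · exact congrArg Sum.inl (hi hxy)
    · exact absurd ⟨x, hxy⟩ y.2
    · exact absurd ⟨y, hxy.symm⟩ x.2
    · exact congrArg Sum.inr (Subtype.ext hxy)
  · intro z
    by_cases hz : z ∈ Set.range i
    · obtain ⟨x, hx⟩ := hz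
      exact ⟨Sum.inl x, hx⟩
    · exact ⟨Sum.inr ⟨z, hz⟩, rfl⟩

open scoped Pointwise in
/-- The dependent product of `p : A → X` along `f : X → Y`. A section of `p` over a fibre of `f`
is represented by its image. -/
def depProd {X Y A : FinGSet G} (f : X →[G] Y) (p : A →[G] X) : FinGSet G where
  carrier := {a : Y × Set A // (∀ b ∈ a.2, f (p b) = a.1) ∧
    ∀ x, f x = a.1 → ∃! b, b ∈ a.2 ∧ p b = x}
  action :=
    { smul := fun c a => ⟨(c • a.1.1, c • a.1.2), by
        refine ⟨fun b hb => ?_, fun x hx => ?_⟩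
        · obtain ⟨b, hb, rfl⟩ := hb
          change f (p (c • b)) = c • a.1.1
          rw [map_smul, map_smul, a.2.1 b hb]
        · obtain ⟨b, ⟨hb, hbx⟩, hu⟩ := a.2.2 (c⁻¹ • x) (by
            rw [map_smul, hx]
            exact inv_smul_smul c _)
          refine ⟨c • b, ⟨Set.smul_mem_smul_set hb, ?_⟩, ?_⟩
          · rw [map_smul, hbx, smul_inv_smul]
          · rintro d ⟨hd, hdx⟩
            rw [← hu (c⁻¹ • d) ⟨Set.mem_smul_set_iff_inv_smul_mem.mp hd, by rw [map_smul, hdx]⟩,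
              smul_inv_smul]⟩
      one_smul := fun a => Subtype.ext (Prod.ext (one_smul G a.1.1) (one_smul G a.1.2))
      mul_smul := fun b c a =>
        Subtype.ext (Prod.ext (mul_smul b c a.1.1) (mul_smul b c a.1.2)) }

/-- The structure map of a dependent product. -/
def depProdMap {X Y A : FinGSet G} (f : X →[G] Y) (p : A →[G] X) : depProd f p →[G] Y where
  toFun a := a.1.1
  map_smul' _ _ := rfl

open scoped Pointwise in
/-- The pairs of a section of `p` over a fibre of `f` and a value of this section. -/
def evalDomain {X Y A : FinGSet G} (f : X →[G] Y) (p : A →[G] X) : FinGSet G where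
  carrier := {a : A × depProd f p // a.1 ∈ a.2.1.2}
  action :=
    { smul := fun c a => ⟨c • a.1, Set.smul_mem_smul_set a.2⟩
      one_smul := fun a => Subtype.ext (one_smul G a.1)
      mul_smul := fun b c a => Subtype.ext (mul_smul b c a.1) }

/-- The evaluation of sections. -/
def eval {X Y A : FinGSet G} (f : X →[G] Y) (p : A →[G] X) : evalDomain f p →[G] A where
  toFun a := a.1.1
  map_smul' _ _ := rfl

/-- The projection of the domain of the evaluation to the dependent product. -/
def evalProj {X Y A : FinGSet G} (f : X →[G] Y) (p : A →[G] X) :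
    evalDomain f p →[G] depProd f p where
  toFun a := a.1.2
  map_smul' _ _ := rfl

theorem isExponential_depProd {X Y A : FinGSet G} (f : X →[G] Y) (p : A →[G] X) :
    IsExponential f p (eval f p) (evalProj f p) (depProdMap f p) := by
  refine ⟨⟨fun a => a.1.2.2.1 a.1.1 a.2, fun x π h => ?_⟩, fun y s hs => ?_⟩
  · obtain ⟨b, ⟨hb, hbx⟩, hu⟩ := π.2.2 x h
    refine ⟨⟨(b, π), hb⟩, ⟨hbx, rfl⟩, ?_⟩
    rintro ⟨⟨b', π'⟩, hb'⟩ ⟨h1, rfl⟩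
    exact Subtype.ext (Prod.ext (hu b' ⟨hb', h1⟩) rfl)
  · refine ⟨⟨(y, Set.range s), ?_, ?_⟩, ⟨rfl, ?_⟩, ?_⟩
    · rintro _ ⟨x, rfl⟩
      rw [hs]
      exact x.2
    · intro x hx
      refine ⟨s ⟨x, hx⟩, ⟨⟨_, rfl⟩, hs _⟩, ?_⟩
      rintro _ ⟨⟨x', rfl⟩, rfl⟩
      exact congrArg s (Subtype.ext (hs x').symm)
    · rintro ⟨⟨b, π⟩, hb⟩ rfl h
      obtain ⟨x, hx⟩ := hb
      change s x = b at hx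
      change b = s ⟨p b, h⟩
      exact hx.symm.trans (congrArg s (Subtype.ext ((hs x).symm.trans (congrArg p hx))))
    · rintro ⟨⟨y', S⟩, h1, h2⟩ ⟨hy, hS⟩
      obtain rfl : y' = y := hy
      refine Subtype.ext (Prod.ext rfl ?_)
      change S = Set.range s
      ext b
      constructor
      · intro hb
        exact ⟨_, (hS ⟨(b, ⟨(y', S), h1, h2⟩), hb⟩ rfl (h1 b hb)).symm⟩
      · rintro ⟨x, rfl⟩
        obtain ⟨b, ⟨hb, hbx⟩, -⟩ := h2 x.1 x.2
        have := hS ⟨(b, ⟨(y', S), h1, h2⟩), hb⟩ rfl (h1 b hb)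
        change b = s ⟨p b, _⟩ at this
        have hx : (⟨p b, h1 b hb⟩ : {x : X // f x = y'}) = x := Subtype.ext hbx
        rw [hx] at this
        exact this ▸ hb

/-- The fibre of the fold map over `y` has two points, and a section of `f ⊔ id` over it is a point
of `X` above `y`; so the dependent product is `X`. Since the norm along a fold map is
multiplication, the distributive law here becomes Frobenius reciprocity. -/
theorem isExponential_fold {X Y : FinGSet G} (f : X →[G] Y) :
    IsExponential (desc (MulActionHom.id G) (MulActionHom.id G) : sum Y Y →[G] Y)
      (desc ((inl Y Y).comp f) (inr Y Y) : sum X Y →[G] sum Y Y)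
      (desc (inl X Y) ((inr X Y).comp f) : sum X X →[G] sum X Y)
      (desc (MulActionHom.id G) (MulActionHom.id G)) f := by
  refine ⟨⟨?_, ?_⟩, ?_⟩
  · rintro (x | x) <;> rfl
  · rintro (y | y) x h
    · obtain rfl : y = f x := h
      refine ⟨Sum.inl x, ⟨rfl, rfl⟩, ?_⟩
      rintro (x' | x') ⟨h1, h2⟩
      · exact congrArg Sum.inl h2
      · cases h1
    · obtain rfl : y = f x := h
      refine ⟨Sum.inr x, ⟨rfl, rfl⟩, ?_⟩
      rintro (x' | x') ⟨h1, h2⟩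
      · cases h1
      · exact congrArg Sum.inr h2
  · intro y s hs
    have hl := hs ⟨Sum.inl y, rfl⟩
    have hr := hs ⟨Sum.inr y, rfl⟩
    rcases hsl : s ⟨Sum.inl y, rfl⟩ with x | x
    swap
    · rw [hsl] at hl
      cases hl
    rcases hsr : s ⟨Sum.inr y, rfl⟩ with x' | x'
    · rw [hsr] at hr
      cases hr
    rw [hsl] at hl
    rw [hsr] at hr
    obtain rfl : f x = y := Sum.inl_injective hl
    obtain rfl : x' = f x := Sum.inr_injective hr
    refine ⟨x, ⟨rfl, ?_⟩, ?_⟩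
    · rintro (z | z) hz h
      · obtain rfl : z = x := hz
        exact hsl.symm
      · obtain rfl : z = x := hz
        exact hsr.symm
    · rintro z ⟨hz, hz'⟩
      have h1 := hz' (Sum.inl z) rfl hz
      have h2 : (⟨Sum.inl (f z), hz⟩ :
          {w : sum Y Y // (desc (MulActionHom.id G) (MulActionHom.id G) : sum Y Y →[G] Y) w = f x})
          = ⟨Sum.inl (f x), rfl⟩ := Subtype.ext (congrArg Sum.inl hz)
      have h3 : (Sum.inl z : X ⊕ Y) = Sum.inl x := (h1.trans (congrArg s h2)).trans hsl
      exact Sum.inl_injective h3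

/-- The `G`-map `G/K → X` that sends the coset of `1` to `x`. -/
def orbitMap [Finite G] {X : FinGSet G} {K : Subgroup G} (x : X)
    (h : K ≤ MulAction.stabilizer G x) : orbit K →[G] X where
  toFun a := Quotient.liftOn' a (fun g => g • x) fun a b hab => by
    have := h (QuotientGroup.leftRel_apply.mp hab)
    rw [MulAction.mem_stabilizer_iff, mul_smul, inv_smul_eq_iff] at this
    exact this.symm
  map_smul' c a := by
    induction a using Quotient.inductionOn' with
    | _ a => exact mul_smul c a x

theorem orbitMap_stabilizer_injective [Finite G] {X : FinGSet G} (x : X) :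
    Function.Injective (orbitMap x (le_refl (MulAction.stabilizer G x))) := by
  intro a b hab
  induction a using Quotient.inductionOn' with
  | _ a =>
  induction b using Quotient.inductionOn' with
  | _ b =>
  refine Quotient.sound' (QuotientGroup.leftRel_apply.mpr ?_)
  rw [MulAction.mem_stabilizer_iff, mul_smul, inv_smul_eq_iff]
  exact hab.symm

theorem surjective_of_orbit [Finite G] {X : FinGSet G} [Nonempty X] {L : Subgroup G}
    (f : X →[G] orbit L) : Function.Surjective f := by
  intro b
  obtain ⟨x⟩ := ‹Nonempty X›
  have : MulAction.IsPretransitive G (orbit L) :=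
    inferInstanceAs (MulAction.IsPretransitive G (G ⧸ L))
  obtain ⟨g, hg⟩ := MulAction.exists_smul_eq G (f x) b
  exact ⟨g • x, by rw [map_smul, hg]⟩

instance [Finite G] (K : Subgroup G) : Nonempty (orbit K) :=
  inferInstanceAs (Nonempty (G ⧸ K))

end

end FinGSet

/-! ### Additivity over disjoint unions and Frobenius reciprocity. -/

namespace TambaraFunctor

open FinGSet

section
variable {G : Type u} [Group G] (R : TambaraFunctor.{u, v} G)

theorem res_tr_of_injective {X Z : FinGSet G} {i : X →[G] Z} (hi : Function.Injective i)
    (a : R.obj X) : R.res i (R.tr i a) = a := by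
  rw [R.res_tr _ _ _ _ (isPullback_of_injective hi), R.res_id, R.tr_id]

theorem res_nm_of_injective {X Z : FinGSet G} {i : X →[G] Z} (hi : Function.Injective i)
    (a : R.obj X) : R.res i (R.nm i a) = a := by
  rw [R.res_nm _ _ _ _ (isPullback_of_injective hi), R.res_id, R.nm_id]

/-- Disjoint summands have empty fibre product, where the ring is zero. So transfer along a summand
extends by zero; the norm extends by one. -/
theorem res_tr_eq_zero {X Y Z : FinGSet G} {i : X →[G] Z} {j : Y →[G] Z}
    (h : IsCoproduct i j) (a : R.obj X) : R.res j (R.tr i a) = 0 := by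
  have := R.subsingleton_obj (empty G) (inferInstanceAs (IsEmpty PEmpty))
  rw [R.res_tr _ _ _ _ h.isPullback_empty,
    Subsingleton.elim (R.res (fromEmpty X) a) 0, map_zero]

theorem res_nm_eq_one {X Y Z : FinGSet G} {i : X →[G] Z} {j : Y →[G] Z}
    (h : IsCoproduct i j) (a : R.obj X) : R.res j (R.nm i a) = 1 := by
  have := R.subsingleton_obj (empty G) (inferInstanceAs (IsEmpty PEmpty))
  rw [R.res_nm _ _ _ _ h.isPullback_empty,
    Subsingleton.elim (R.res (fromEmpty X) a) 1, map_one]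

theorem eq_of_res_eq {X Y Z : FinGSet G} {i : X →[G] Z} {j : Y →[G] Z}
    (h : IsCoproduct i j) {a b : R.obj Z} (hi : R.res i a = R.res i b)
    (hj : R.res j a = R.res j b) : a = b :=
  (R.bijective_res i j h).1 (Prod.ext hi hj)

theorem tr_res_add_tr_res {X Y Z : FinGSet G} {i : X →[G] Z} {j : Y →[G] Z}
    (h : IsCoproduct i j) (a : R.obj Z) :
    R.tr i (R.res i a) + R.tr j (R.res j a) = a := by
  apply R.eq_of_res_eq h
  · rw [map_add, R.res_tr_of_injective h.injective_left, R.res_tr_eq_zero h.symm, add_zero]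
  · rw [map_add, R.res_tr_of_injective h.symm.injective_left, R.res_tr_eq_zero h, zero_add]

theorem nm_res_mul_nm_res {X Y Z : FinGSet G} {i : X →[G] Z} {j : Y →[G] Z}
    (h : IsCoproduct i j) (a : R.obj Z) :
    R.nm i (R.res i a) * R.nm j (R.res j a) = a := by
  apply R.eq_of_res_eq h
  · rw [map_mul, R.res_nm_of_injective h.injective_left, R.res_nm_eq_one h.symm, mul_one]
  · rw [map_mul, R.res_nm_of_injective h.symm.injective_left, R.res_nm_eq_one h, one_mul]

/-- The element of `R(X ⊔ Y)` with given components. -/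
def pair {X Y : FinGSet G} (a : R.obj X) (b : R.obj Y) : R.obj (sum X Y) :=
  R.tr (inl X Y) a + R.tr (inr X Y) b

theorem res_inl_pair {X Y : FinGSet G} (a : R.obj X) (b : R.obj Y) :
    R.res (inl X Y) (R.pair a b) = a := by
  rw [pair, map_add, R.res_tr_of_injective (isCoproduct_sum X Y).injective_left,
    R.res_tr_eq_zero (isCoproduct_sum X Y).symm, add_zero]

theorem res_inr_pair {X Y : FinGSet G} (a : R.obj X) (b : R.obj Y) :
    R.res (inr X Y) (R.pair a b) = b := by
  rw [pair, map_add, R.res_tr_of_injective (isCoproduct_sum X Y).symm.injective_left,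
    R.res_tr_eq_zero (isCoproduct_sum X Y), zero_add]

theorem tr_desc {X Y Z : FinGSet G} (f : X →[G] Z) (g : Y →[G] Z) (a : R.obj (sum X Y)) :
    R.tr (desc f g) a = R.tr f (R.res (inl X Y) a) + R.tr g (R.res (inr X Y) a) := by
  conv_lhs => rw [← R.tr_res_add_tr_res (isCoproduct_sum X Y) a]
  rw [map_add, ← R.tr_comp, ← R.tr_comp]
  rfl

theorem nm_desc {X Y Z : FinGSet G} (f : X →[G] Z) (g : Y →[G] Z) (a : R.obj (sum X Y)) :
    R.nm (desc f g) a = R.nm f (R.res (inl X Y) a) * R.nm g (R.res (inr X Y) a) := by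
  conv_lhs => rw [← R.nm_res_mul_nm_res (isCoproduct_sum X Y) a]
  rw [map_mul, ← R.nm_comp, ← R.nm_comp]
  rfl

/-- Frobenius reciprocity. -/
theorem tr_mul_res {X Y : FinGSet G} (f : X →[G] Y) (a : R.obj X) (b : R.obj Y) :
    R.tr f (a * R.res f b) = R.tr f a * b := by
  -- The left side of `h` unfolds to `tr f a * b`, the right side to `tr f (a * res f b)`.
  have h := R.nm_tr _ _ _ _ _ (isExponential_fold f) (R.pair a b)
  rw [nm_desc, nm_desc, tr_desc, res_inl_pair, res_inr_pair, R.tr_comp] at h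
  have h1 : R.res (inl Y Y) (R.tr (inl Y Y) (R.tr f a) + R.tr (inr Y Y) b) = R.tr f a :=
    R.res_inl_pair _ _
  have h2 : R.res (inr Y Y) (R.tr (inl Y Y) (R.tr f a) + R.tr (inr Y Y) b) = b :=
    R.res_inr_pair _ _
  rw [h1, h2, ← R.res_comp, ← R.res_comp] at h
  simp only [nm_id] at h
  rw [h]
  congr 2
  · exact (R.res_inl_pair a b).symm
  · conv_lhs => rw [← R.res_inr_pair a b]
    exact (R.res_comp _ _ _).symm

theorem tr_mul_tr {X Y Z : FinGSet G} (f : X →[G] Z) (g : Y →[G] Z) (a : R.obj X)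
    (b : R.obj Y) : R.tr f a * R.tr g b =
      R.tr (f.comp (fst f g)) (R.res (fst f g) a * R.res (snd f g) b) := by
  have h : IsPullback (snd f g) (fst f g) g f :=
    ⟨fun x => (x.2).symm, fun x y h => ⟨⟨(y, x), h.symm⟩, ⟨rfl, rfl⟩,
      fun _ hb => Subtype.ext (Prod.ext hb.2 hb.1)⟩⟩
  rw [← R.tr_mul_res, R.res_tr _ _ _ _ h, mul_comm a, ← R.tr_mul_res, ← R.tr_comp, mul_comm]

/-- An additive subgroup of `R(X)` contains `a` if it contains the components of `a` on the
orbits of `X`. -/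
theorem mem_of_forall_tr_res_mem [Finite G] {X : FinGSet G} (S : AddSubgroup (R.obj X))
    (a : R.obj X) (h : ∀ (L : Subgroup G) (f : orbit L →[G] X), R.tr f (R.res f a) ∈ S) :
    a ∈ S := by
  induction hn : Nat.card X using Nat.strong_induction_on generalizing X with
  | _ n ih =>
  rcases isEmpty_or_nonempty X with hX | ⟨⟨x⟩⟩
  · have := R.subsingleton_obj X hX
    rw [Subsingleton.elim a 0]
    exact S.zero_mem
  · have hc := isCoproduct_compl (orbitMap_stabilizer_injective x)
    rw [← R.tr_res_add_tr_res hc a]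
    refine S.add_mem (h _ _) ?_
    -- The complement of the orbit of `x` omits `x`, so it is smaller; the subgroup is pulled back
    -- to it along the transfer.
    refine ih _ ?_ (S.comap (R.tr (complIncl _))) _ (fun L f => ?_) rfl
    · subst hn
      refine Finite.card_subtype_lt (x := x) ?_
      simp only [not_not]
      exact ⟨((1 : G) : G ⧸ _), one_smul G x⟩
    · rw [AddSubgroup.mem_comap, ← R.tr_comp, ← R.res_comp]
      exact h _ _

end

end TambaraFunctor

/-! ### Values of Tambara ideals on arbitrary finite `G`-sets, and products of ideals. -/

namespace TambaraIdeal

open FinGSet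

section
variable {G : Type u} [Group G] [Finite G] {R : TambaraFunctor.{u, v} G}

theorem mem_value {I : TambaraIdeal R} {X : FinGSet G} {a : R.obj X} :
    a ∈ I.value X ↔ ∀ (L : Subgroup G) (f : orbit L →[G] X), R.res f a ∈ I.level L := by
  simp only [value, Submodule.mem_iInf, Ideal.mem_comap]

theorem value_orbit (I : TambaraIdeal R) (K : Subgroup G) : I.value (orbit K) = I.level K := by
  ext a
  rw [mem_value]
  refine ⟨fun h => ?_, fun h L f => I.res_mem f h⟩
  rw [← R.res_id _ a]
  exact h K _

theorem value_mono {I J : TambaraIdeal R} (h : I ≤ J) (X : FinGSet G) : I.value X ≤ J.value X :=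
  fun _ ha => mem_value.mpr fun L f => h L (mem_value.mp ha L f)

theorem res_mem_value (I : TambaraIdeal R) {X Y : FinGSet G} (f : X →[G] Y) {a : R.obj Y}
    (ha : a ∈ I.value Y) : R.res f a ∈ I.value X :=
  mem_value.mpr fun L g => by
    rw [← R.res_comp]
    exact mem_value.mp ha L _

theorem tr_mem_value (I : TambaraIdeal R) {X Y : FinGSet G} (f : X →[G] Y) {a : R.obj X}
    (ha : a ∈ I.value X) : R.tr f a ∈ I.value Y :=
  mem_value.mpr fun L g => by
    rw [R.res_tr _ _ _ _ (isPullback_fiberProd f g)]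
    refine R.mem_of_forall_tr_res_mem
      ((I.level L).toAddSubgroup.comap (R.tr (snd f g))) _ fun M k => ?_
    rw [AddSubgroup.mem_comap, ← R.tr_comp]
    exact I.tr_mem _ (mem_value.mp (I.res_mem_value _ ha) M k)

/-- Over an empty fibre a norm equals 1, hence the surjectivity assumption. After base change to an
orbit the source is nonempty; splitting off one of its orbits factors the norm, and that one factor
in the ideal suffices. -/
theorem nm_mem_value (I : TambaraIdeal R) {X Y : FinGSet G} (f : X →[G] Y)
    (hf : Function.Surjective f) {a : R.obj X} (ha : a ∈ I.value X) : R.nm f a ∈ I.value Y :=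
  mem_value.mpr fun L g => by
    rw [R.res_nm _ _ _ _ (isPullback_fiberProd f g)]
    obtain ⟨x, -⟩ := (isPullback_fiberProd f g).surjective hf (Classical.arbitrary (orbit L))
    rw [← R.nm_res_mul_nm_res (isCoproduct_compl (orbitMap_stabilizer_injective x))
      (R.res (fst f g) a), map_mul, ← R.nm_comp]
    exact Ideal.mul_mem_right _ _
      (I.nm_mem _ (mem_value.mp (I.res_mem_value _ ha) _ _))

theorem le_span (s : ∀ K : Subgroup G, Set (R.obj (orbit K))) (K : Subgroup G) :
    s K ⊆ (span s).level K := fun a ha => by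
  change a ∈ (⨅ I ∈ _, TambaraIdeal.level I K : Ideal _)
  simp only [Submodule.mem_iInf]
  exact fun I hI => hI K ha

theorem span_le {s : ∀ K : Subgroup G, Set (R.obj (orbit K))} {I : TambaraIdeal R} :
    span s ≤ I ↔ ∀ K, s K ⊆ I.level K := by
  refine ⟨fun h K => (le_span s K).trans (h K), fun h K => ?_⟩
  exact iInf₂_le_of_le I h le_rfl

theorem mul_mem_mul {I J : TambaraIdeal R} {K : Subgroup G} {a b : R.obj (orbit K)}
    (ha : a ∈ I.level K) (hb : b ∈ J.level K) : a * b ∈ (I * J).level K :=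
  le_span _ K ⟨a, ha, b, hb, rfl⟩

theorem mul_le {I J p : TambaraIdeal R} : I * J ≤ p ↔
    ∀ K, ∀ a ∈ I.level K, ∀ b ∈ J.level K, a * b ∈ p.level K := by
  refine ⟨fun h K a ha b hb => h K (mul_mem_mul ha hb), fun h => span_le.mpr fun K => ?_⟩
  rintro _ ⟨a, ha, b, hb, rfl⟩
  exact h K a ha b hb

theorem mul_mem_value_mul {I J : TambaraIdeal R} {X : FinGSet G} {a b : R.obj X}
    (ha : a ∈ I.value X) (hb : b ∈ J.value X) : a * b ∈ (I * J).value X :=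
  mem_value.mpr fun L f => by
    rw [map_mul]
    exact mul_mem_mul (mem_value.mp ha L f) (mem_value.mp hb L f)

/-- Properness in terms of the order alone, so that it passes through an order isomorphism. -/
theorem exists_level_ne_top_iff {p : TambaraIdeal R} :
    (∃ K, p.level K ≠ ⊤) ↔ ∃ I : TambaraIdeal R, ¬ I ≤ p := by
  constructor
  · rintro ⟨K, hK⟩
    refine ⟨⟨fun _ => ⊤, fun _ _ _ => trivial, fun _ _ _ => trivial, fun _ _ _ => trivial⟩,
      fun h => hK (top_le_iff.mp (h K))⟩
  · rintro ⟨I, hI⟩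
    by_contra! h
    exact hI fun K => by
      rw [h K]
      exact le_top

end

end TambaraIdeal
-- Induction of transitive `H`-sets to `G`.
namespace FinGSet

section
variable {G : Type u} [Group G] [Finite G] (H : Subgroup G)

/-- The inclusion of `H/L` into the underlying `H`-set of `G/L`, the `G`-set induced by `H/L`. -/
def unit (L : Subgroup H) : orbit L →[H] (orbit (L.map H.subtype)).restrict H :=
  orbitMap (X := (orbit (L.map H.subtype)).restrict H) ((1 : G) : G ⧸ L.map H.subtype)
    fun h hh => by
      refine MulAction.mem_stabilizer_iff.mpr ?_
      refine QuotientGroup.eq.mpr ?_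
      change ((h : G) * 1)⁻¹ * 1 ∈ _
      rw [mul_one, mul_one]
      exact inv_mem ⟨h, hh, rfl⟩

variable {H}

theorem unit_mk (L : Subgroup H) (h : H) :
    unit H L (show orbit L from (h : H ⧸ L)) = ((h : G) : G ⧸ L.map H.subtype) :=
  congrArg (fun g : G => (g : G ⧸ L.map H.subtype)) (mul_one (h : G))

theorem unit_injective (L : Subgroup H) : Function.Injective (unit H L) := by
  intro a b hab
  induction a using Quotient.inductionOn' with
  | _ a =>
  induction b using Quotient.inductionOn' with
  | _ b =>
  have h := ((unit_mk L a).symm.trans hab).trans (unit_mk L b)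
  obtain ⟨c, hc, hcab⟩ := QuotientGroup.eq.mp h
  refine QuotientGroup.eq.mpr ?_
  obtain rfl : c = a⁻¹ * b := Subtype.ext hcab
  exact hc

/-- The `G`-map out of the induced `G`-set `G/L` that corresponds to an `H`-map out of `H/L`. -/
def extend {X : FinGSet G} {L : Subgroup H} (f : orbit L →[H] X.restrict H) :
    orbit (L.map H.subtype) →[G] X :=
  orbitMap (f ((1 : H) : H ⧸ L) : X) fun g hg => by
    obtain ⟨h, hh, rfl⟩ := hg
    refine MulAction.mem_stabilizer_iff.mpr ?_
    refine (f.map_smul h ((1 : H) : H ⧸ L)).symm.trans (congrArg f ?_)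
    refine QuotientGroup.eq.mpr ?_
    change (h * 1)⁻¹ * 1 ∈ L
    rw [mul_one, mul_one]
    exact inv_mem hh

theorem extend_comp_unit {X : FinGSet G} {L : Subgroup H} (f : orbit L →[H] X.restrict H) :
    (restrictMap H (extend f)).comp (unit H L) = f := by
  ext a
  induction a using Quotient.inductionOn' with
  | _ a =>
  refine (congrArg (extend f) (unit_mk L a)).trans ?_
  refine (f.map_smul a ((1 : H) : H ⧸ L)).symm.trans (congrArg f ?_)
  exact congrArg (fun h : H => (h : H ⧸ L)) (mul_one a)

/-- The `G`-map `G/L → G/M` induced by an `H`-map `H/L → H/M`. -/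
def induce {L M : Subgroup H} (f : orbit L →[H] orbit M) :
    orbit (L.map H.subtype) →[G] orbit (M.map H.subtype) :=
  extend ((unit H M).comp f)

theorem induce_comp_unit {L M : Subgroup H} (f : orbit L →[H] orbit M) :
    (restrictMap H (induce f)).comp (unit H L) = (unit H M).comp f :=
  extend_comp_unit _

/-- The preimage of `H/M` under `G/L → G/M` is no larger than `H/L`: if `f` sends the base coset to
`kM` and `gkM = mM` with `k`, `m` in `H`, then `M ≤ H` forces `g ∈ H`. -/
theorem isPullback_induce {L M : Subgroup H} (f : orbit L →[H] orbit M) :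
    IsPullback (unit H L) f (restrictMap H (induce f)) (unit H M) := by
  have hcomm : ∀ a, restrictMap H (induce f) (unit H L a) = unit H M (f a) :=
    fun a => DFunLike.congr_fun (induce_comp_unit f) a
  refine ⟨hcomm, fun x y hxy => ?_⟩
  suffices h : ∃ a, unit H L a = x by
    obtain ⟨a, rfl⟩ := h
    exact ⟨a, ⟨rfl, unit_injective M ((hcomm a).symm.trans hxy)⟩,
      fun b hb => unit_injective L hb.1⟩
  obtain ⟨k, hk⟩ := QuotientGroup.mk_surjective (s := M) (f ((1 : H) : H ⧸ L))
  induction x using Quotient.inductionOn' with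
  | _ g =>
  induction y using Quotient.inductionOn' with
  | _ m =>
  have h1 : (((g * k : G)) : G ⧸ M.map H.subtype) = ((m : G) : G ⧸ M.map H.subtype) := by
    refine Eq.trans ?_ (hxy.trans (unit_mk M m))
    change _ = g • (show G ⧸ M.map H.subtype from unit H M (f ((1 : H) : H ⧸ L)))
    rw [← hk]
    exact (congrArg (fun z : G ⧸ M.map H.subtype => g • z) (unit_mk M k)).symm
  obtain ⟨c, -, hc⟩ := QuotientGroup.eq.mp h1
  have hg : g ∈ H := by
    have : g = (m * c⁻¹ * k⁻¹ : H) := by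
      have hc' : (c : G) = (g * k)⁻¹ * m := hc
      push_cast
      rw [hc']
      group
    rw [this]
    exact SetLike.coe_mem _
  exact ⟨((⟨g, hg⟩ : H) : H ⧸ L), unit_mk L ⟨g, hg⟩⟩

end

end FinGSet

/-! ### Coinduction of Tambara ideals and its inverse. -/

namespace TambaraIdeal

open FinGSet

section
variable {G : Type u} [Group G] [Finite G] {H : Subgroup G} {R : TambaraFunctor.{u, v} H}

/-- The coinduction of a Tambara ideal. -/
def coind (I : TambaraIdeal R) : TambaraIdeal (R.coind H) where
  level K := I.coindLevel H K
  res_mem f _ ha := I.res_mem_value (restrictMap H f) ha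
  tr_mem f _ ha := I.tr_mem_value (restrictMap H f) ha
  nm_mem f _ ha := I.nm_mem_value (restrictMap H f) (surjective_of_orbit f) ha

theorem mem_coind {I : TambaraIdeal R} {K : Subgroup G} {a : R.obj ((orbit K).restrict H)} :
    a ∈ (coind I).level K ↔ a ∈ I.value ((orbit K).restrict H) := Iff.rfl

theorem tr_unit_mem_coind_iff {I : TambaraIdeal R} {L : Subgroup H} {a : R.obj (orbit L)} :
    R.tr (unit H L) a ∈ (coind I).level (L.map H.subtype) ↔ a ∈ I.level L := by
  rw [mem_coind]
  constructor
  · intro h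
    rw [← R.res_tr_of_injective (unit_injective L) a]
    exact mem_value.mp h L _
  · intro h
    exact I.tr_mem_value _ ((I.value_orbit L).symm ▸ h)

theorem coind_le_coind_iff {I J : TambaraIdeal R} : coind (H := H) I ≤ coind J ↔ I ≤ J := by
  refine ⟨fun h L a ha => ?_, fun h K => value_mono h _⟩
  exact tr_unit_mem_coind_iff.mp (h _ (tr_unit_mem_coind_iff.mpr ha))

/-- By Frobenius reciprocity, projecting to the summand `H/L` is multiplication by `tr (unit H L)
1`, which preserves any ideal. -/
theorem tr_unit_res_mem (J : TambaraIdeal (R.coind H)) {L : Subgroup H}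
    {a : R.obj ((orbit (L.map H.subtype)).restrict H)} (ha : a ∈ J.level (L.map H.subtype)) :
    R.tr (unit H L) (R.res (unit H L) a) ∈ J.level (L.map H.subtype) := by
  rw [← one_mul (R.res (unit H L) a), R.tr_mul_res]
  exact Ideal.mul_mem_left (J.level (L.map H.subtype)) _ ha

/-- The Tambara ideal of `R` whose coinduction is a given Tambara ideal of `R.coind H`. -/
def descend (J : TambaraIdeal (R.coind H)) : TambaraIdeal R where
  level L :=
    { carrier := {a | R.tr (unit H L) a ∈ J.level (L.map H.subtype)}
      zero_mem' := by
        rw [Set.mem_ofPred_eq, map_zero]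
        exact (J.level (L.map H.subtype)).zero_mem
      add_mem' := fun ha hb => by
        rw [Set.mem_ofPred_eq, map_add]
        exact (J.level (L.map H.subtype)).add_mem ha hb
      smul_mem' := fun c a ha => by
        -- Writing `c` as the restriction of its own extension by zero makes Frobenius reciprocity
        -- applicable.
        rw [Set.mem_ofPred_eq, smul_eq_mul, mul_comm,
          ← R.res_tr_of_injective (unit_injective L) c, R.tr_mul_res]
        exact Ideal.mul_mem_right _ (J.level (L.map H.subtype)) ha }
  res_mem {K L} f a ha := by
    change R.tr (unit H K) (R.res f a) ∈ J.level (K.map H.subtype)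
    have h : IsPullback f (unit H K) (unit H L) (restrictMap H (induce f)) :=
      ⟨fun x => ((isPullback_induce f).1 x).symm, fun x y hxy => by
        simpa only [and_comm] using (isPullback_induce f).2 y x hxy.symm⟩
    rw [← R.res_tr _ _ _ _ h]
    exact J.res_mem (induce f) ha
  tr_mem {K L} f a ha := by
    change R.tr (unit H L) (R.tr f a) ∈ J.level (L.map H.subtype)
    rw [← R.tr_comp, ← induce_comp_unit, R.tr_comp]
    exact J.tr_mem (induce f) ha
  nm_mem {K L} f a ha := by
    change R.tr (unit H L) (R.nm f a) ∈ J.level (L.map H.subtype)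
    -- Base change exhibits `nm f a` as the `H/L`-component of the norm, along `induce f`, of the
    -- extension of `a` by zero.
    rw [← R.res_tr_of_injective (unit_injective K) a,
      ← R.res_nm _ _ _ _ (isPullback_induce f)]
    exact J.tr_unit_res_mem (J.nm_mem (induce f) ha)

theorem mem_descend {J : TambaraIdeal (R.coind H)} {L : Subgroup H} {a : R.obj (orbit L)} :
    a ∈ (descend J).level L ↔ R.tr (unit H L) a ∈ J.level (L.map H.subtype) := Iff.rfl

/-- An element of `J` is determined by its orbit components. Each orbit map `f` factors as `extend
f` after `unit`, so a component is a transfer along the `G`-map `extend f` of an extension by zero,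
and `J` is closed under such transfers and restrictions. -/
theorem coind_descend (J : TambaraIdeal (R.coind H)) : coind (descend J) = J := by
  refine TambaraIdeal.ext (funext fun K => Ideal.ext fun a => ?_)
  refine mem_coind.trans (mem_value.trans ?_)
  constructor
  · intro h
    refine R.mem_of_forall_tr_res_mem (J.level K).toAddSubgroup a fun L f => ?_
    have hf := R.tr_comp (restrictMap H (extend f)) (unit H L) (R.res f a)
    rw [extend_comp_unit] at hf
    rw [hf]
    exact J.tr_mem (extend f) (h L f)
  · intro h L f
    have hf := R.res_comp (restrictMap H (extend f)) (unit H L) a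
    rw [extend_comp_unit] at hf
    rw [mem_descend, hf]
    exact J.tr_unit_res_mem (J.res_mem (extend f) h)

/-- Coinduction as an isomorphism of partially ordered sets. -/
noncomputable def coindIso (R : TambaraFunctor.{u, v} H) :
    TambaraIdeal R ≃o TambaraIdeal (R.coind H) where
  toFun := coind
  invFun := descend
  left_inv I := by
    have h := coind_descend (coind I)
    exact le_antisymm (coind_le_coind_iff.mp h.le) (coind_le_coind_iff.mp h.ge)
  right_inv := coind_descend
  map_rel_iff' := coind_le_coind_iff

theorem coind_mul (I J : TambaraIdeal R) : coind (H := H) (I * J) = coind I * coind J := by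
  refine le_antisymm ?_ (mul_le.mpr fun K a ha b hb => mul_mem_value_mul ha hb)
  rw [← coind_descend (coind I * coind J), coind_le_coind_iff]
  refine mul_le.mpr fun L a ha b hb => mem_descend.mpr ?_
  -- Extension by zero is multiplicative, so the extension of `a * b` is a product of elements of
  -- the two coinduced ideals.
  rw [← R.res_tr_of_injective (unit_injective L) b, R.tr_mul_res]
  exact mul_mem_mul (R := R.coind H) (tr_unit_mem_coind_iff.mpr ha) (tr_unit_mem_coind_iff.mpr hb)

theorem isPrime_coind_iff {p : TambaraIdeal R} : (coind (H := H) p).IsPrime ↔ p.IsPrime := by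
  unfold IsPrime
  rw [exists_level_ne_top_iff, exists_level_ne_top_iff]
  refine and_congr ?_ ?_
  · rw [(coindIso R).surjective.exists]
    exact exists_congr fun I => not_congr coind_le_coind_iff
  · rw [(coindIso R).surjective.forall₂]
    refine forall₂_congr fun I J => ?_
    change (coind I * coind J ≤ coind p → coind I ≤ coind p ∨ coind J ≤ coind p) ↔ _
    rw [← coind_mul, coind_le_coind_iff, coind_le_coind_iff, coind_le_coind_iff]

theorem comap_coind {S : TambaraFunctor.{u, v} H} (φ : R.Hom S) (J : TambaraIdeal S) :
    (coind J).comap (φ.coind H) = coind (J.comap φ) := by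
  refine TambaraIdeal.ext (funext fun K => Ideal.ext fun a => ?_)
  change φ.app _ a ∈ J.value _ ↔ a ∈ (J.comap φ).value _
  refine mem_value.trans (Iff.trans ?_ mem_value.symm)
  refine forall₂_congr fun L f => ?_
  exact iff_of_eq (congrArg (· ∈ J.level L) (φ.app_res f a).symm)

end

/-! ### Extension and contraction of ideals along a morphism. -/

section
variable {G : Type u} [Group G] [Finite G] {R S : TambaraFunctor.{u, v} G}

theorem app_mem_value {φ : R.Hom S} {J : TambaraIdeal S} {X : FinGSet G} {a : R.obj X}
    (ha : a ∈ (J.comap φ).value X) : φ.app X a ∈ J.value X :=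
  mem_value.mpr fun L f => by
    rw [← φ.app_res]
    exact mem_value.mp ha L f

/-- The Tambara ideal generated by the image of a Tambara ideal under a morphism. -/
def map (φ : R.Hom S) (I : TambaraIdeal R) : TambaraIdeal S where
  level K :=
    -- Allowing every finite `Y`, not only orbits, turns a sum of two such elements into a single
    -- one over a disjoint union.
    { carrier := {a | ∃ (Y : FinGSet G) (u : Y →[G] orbit K) (c : S.obj Y), ∃ x ∈ I.value Y,
        a = S.tr u (c * φ.app Y x)}
      zero_mem' := ⟨orbit K, MulActionHom.id G, 0, 0, Ideal.zero_mem _, by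
        rw [zero_mul, map_zero]⟩
      add_mem' := by
        rintro _ _ ⟨Y, u, c, x, hx, rfl⟩ ⟨Z, w, d, y, hy, rfl⟩
        refine ⟨sum Y Z, desc u w, S.pair c d, R.pair x y,
          Ideal.add_mem _ (I.tr_mem_value _ hx) (I.tr_mem_value _ hy), ?_⟩
        rw [S.tr_desc, map_mul (S.res _), map_mul (S.res _), S.res_inl_pair, S.res_inr_pair, ← φ.app_res,
          ← φ.app_res, R.res_inl_pair, R.res_inr_pair]
      smul_mem' := by
        rintro d _ ⟨Y, u, c, x, hx, rfl⟩
        refine ⟨Y, u, S.res u d * c, x, hx, ?_⟩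
        rw [smul_eq_mul, mul_comm, ← S.tr_mul_res, mul_comm, mul_assoc] }
  res_mem f a ha := by
    obtain ⟨Y, u, c, x, hx, rfl⟩ := ha
    refine ⟨fiberProd u f, snd u f, S.res (fst u f) c, R.res (fst u f) x,
      I.res_mem_value _ hx, ?_⟩
    rw [S.res_tr _ _ _ _ (isPullback_fiberProd u f), map_mul, φ.app_res]
  tr_mem f a ha := by
    obtain ⟨Y, u, c, x, hx, rfl⟩ := ha
    exact ⟨Y, f.comp u, c, x, hx, (S.tr_comp _ _ _).symm⟩
  nm_mem f a ha := by
    obtain ⟨Y, u, c, x, hx, rfl⟩ := ha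
    have h := isExponential_depProd f u
    -- The distributive law rewrites the norm of a transfer as a transfer of a norm. As a base
    -- change of the surjection `f`, the map `evalProj f u` is surjective, so the norm of the
    -- restricted `x` stays in `I`.
    refine ⟨depProd f u, depProdMap f u, S.nm (evalProj f u) (S.res (eval f u) c),
      R.nm (evalProj f u) (R.res (eval f u) x),
      I.nm_mem_value _ (h.1.surjective (surjective_of_orbit f)) (I.res_mem_value _ hx), ?_⟩
    rw [S.nm_tr _ _ _ _ _ h, map_mul, map_mul, φ.app_nm, φ.app_res]

theorem le_comap_of_map_le {φ : R.Hom S} {I : TambaraIdeal R} {J : TambaraIdeal S}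
    (h : map φ I ≤ J) : I ≤ J.comap φ := fun K a ha =>
  h K ⟨orbit K, MulActionHom.id G, 1, a, (I.value_orbit K).symm ▸ ha, by
    rw [one_mul, S.tr_id]⟩

/-- By `tr_mul_tr`, a product of two generators is a transfer from a fibre product of a multiple of
`φ(xy)`, with `x` from `A` and `y` from `B`. This is what makes contractions of primes prime. -/
theorem map_mul_map_le {φ : R.Hom S} {A B : TambaraIdeal R} {J : TambaraIdeal S}
    (h : A * B ≤ J.comap φ) : map φ A * map φ B ≤ J := by
  refine mul_le.mpr ?_
  rintro K _ ⟨Y, u, c, x, hx, rfl⟩ _ ⟨Z, w, d, y, hy, rfl⟩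
  rw [S.tr_mul_tr, ← J.value_orbit]
  refine J.tr_mem_value _ ?_
  rw [map_mul, map_mul, mul_mul_mul_comm, ← φ.app_res, ← φ.app_res, ← map_mul]
  exact Ideal.mul_mem_left _ _ (app_mem_value (value_mono h _
    (mul_mem_value_mul (A.res_mem_value _ hx) (B.res_mem_value _ hy))))

theorem IsPrime.comap {p : TambaraIdeal S} (hp : p.IsPrime) (φ : R.Hom S) :
    (p.comap φ).IsPrime := by
  refine ⟨?_, fun A B h => ?_⟩
  · obtain ⟨K, hK⟩ := hp.1
    exact ⟨K, Ideal.comap_ne_top _ hK⟩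
  · exact (hp.2 _ _ (map_mul_map_le h)).imp le_comap_of_map_le le_comap_of_map_le

end

end TambaraIdeal

/-! ### Induced maps of spectra, the homeomorphism and its naturality. -/

namespace NakaokaSpectrum

section
variable {G : Type u} [Group G] [Finite G]

theorem ext {R : TambaraFunctor.{u, v} G} {p q : NakaokaSpectrum R} (h : p.ideal = q.ideal) :
    p = q := Subtype.ext h

theorem continuous_of_preimage_zeroLocus {G' : Type u} [Group G'] [Finite G']
    {R : TambaraFunctor.{u, v} G} {S : TambaraFunctor.{u, v} G'}
    {f : NakaokaSpectrum S → NakaokaSpectrum R}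
    (h : ∀ I, ∃ J, f ⁻¹' zeroLocus I = zeroLocus J) : Continuous f := by
  refine continuous_generateFrom_iff.mpr ?_
  rintro _ ⟨I, rfl⟩
  obtain ⟨J, hJ⟩ := h I
  rw [Set.preimage_compl, hJ]
  exact TopologicalSpace.isOpen_generateFrom_of_mem ⟨J, rfl⟩

/-- The continuous map of spectra induced by a morphism of Tambara functors. -/
def comap {R S : TambaraFunctor.{u, v} G} (φ : R.Hom S) :
    C(NakaokaSpectrum S, NakaokaSpectrum R) where
  toFun p := ⟨p.ideal.comap φ, p.2.comap φ⟩
  continuous_toFun := continuous_of_preimage_zeroLocus fun I => by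
    -- The preimage of `V(I)` is `V(map φ I)`, since extension is left adjoint to contraction.
    refine ⟨TambaraIdeal.map φ I, Set.ext fun p =>
      ⟨fun h => ?_, TambaraIdeal.le_comap_of_map_le⟩⟩
    rintro K _ ⟨Y, u, c, x, hx, rfl⟩
    rw [← p.ideal.value_orbit]
    exact p.ideal.tr_mem_value _ (Ideal.mul_mem_left _ _
      (TambaraIdeal.app_mem_value (TambaraIdeal.value_mono h _ hx)))

/-- The spectrum of a coinduced Tambara functor. -/
noncomputable def coindHomeomorph {H : Subgroup G} (R : TambaraFunctor.{u, v} H) :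
    NakaokaSpectrum (R.coind H) ≃ₜ NakaokaSpectrum R where
  toFun p := ⟨(TambaraIdeal.coindIso R).symm p.ideal, by
    refine TambaraIdeal.isPrime_coind_iff.mp ?_
    have h : TambaraIdeal.coind ((TambaraIdeal.coindIso R).symm p.ideal) = p.ideal :=
      (TambaraIdeal.coindIso R).apply_symm_apply p.ideal
    rw [h]
    exact p.2⟩
  invFun p := ⟨TambaraIdeal.coindIso R p.ideal, TambaraIdeal.isPrime_coind_iff.mpr p.2⟩
  left_inv p := ext ((TambaraIdeal.coindIso R).apply_symm_apply p.ideal)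
  right_inv p := ext ((TambaraIdeal.coindIso R).symm_apply_apply p.ideal)
  continuous_toFun := continuous_of_preimage_zeroLocus fun I =>
    ⟨TambaraIdeal.coindIso R I, Set.ext fun p => (TambaraIdeal.coindIso R).le_symm_apply⟩
  continuous_invFun := continuous_of_preimage_zeroLocus fun I =>
    ⟨(TambaraIdeal.coindIso R).symm I, Set.ext fun p =>
      ((TambaraIdeal.coindIso R).symm_apply_le).symm⟩

theorem coind_ideal_coindHomeomorph {H : Subgroup G} (R : TambaraFunctor.{u, v} H)
    (p : NakaokaSpectrum (R.coind H)) :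
    TambaraIdeal.coindIso R (coindHomeomorph R p).ideal = p.ideal :=
  (TambaraIdeal.coindIso R).apply_symm_apply p.ideal

theorem coindHomeomorph_comap {H : Subgroup G} {R S : TambaraFunctor.{u, v} H} (φ : R.Hom S)
    (q : NakaokaSpectrum (S.coind H)) :
    coindHomeomorph R (comap (φ.coind H) q) = comap φ (coindHomeomorph S q) := by
  apply ext
  -- After coinducing both sides, naturality is the compatibility of contraction with coinduction.
  apply (TambaraIdeal.coindIso R).injective
  rw [coind_ideal_coindHomeomorph]
  refine Eq.trans ?_ (TambaraIdeal.comap_coind φ (coindHomeomorph S q).ideal)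
  exact congrArg (TambaraIdeal.comap (φ.coind H)) (coind_ideal_coindHomeomorph S q).symm

end

end NakaokaSpectrum

theorem mainTheorem1 {G : Type u} [Group G] [Finite G] (H : Subgroup G) :
    ∃ (Φ : ∀ R : TambaraFunctor.{u, v} H, TambaraIdeal R ≃o TambaraIdeal (R.coind H))
      (Ψ : ∀ R : TambaraFunctor.{u, v} H, NakaokaSpectrum (R.coind H) ≃ₜ NakaokaSpectrum R),
      -- the bijection is coinduction of ideals
      (∀ (R : TambaraFunctor.{u, v} H) (I : TambaraIdeal R) (K : Subgroup G),
        (Φ R I).level K = I.coindLevel H K) ∧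
      -- it respects products and primality
      (∀ (R : TambaraFunctor.{u, v} H) (I J : TambaraIdeal R), Φ R (I * J) = Φ R I * Φ R J) ∧
      (∀ (R : TambaraFunctor.{u, v} H) (p : TambaraIdeal R), (Φ R p).IsPrime ↔ p.IsPrime) ∧
      -- the homeomorphism is the inverse of the bijection on prime ideals
      (∀ (R : TambaraFunctor.{u, v} H) (p : NakaokaSpectrum (R.coind H)),
        Φ R (Ψ R p).ideal = p.ideal) ∧
      -- contraction of prime ideals along a morphism of `H`-Tambara functors and along its
      -- coinduction gives continuous maps of spectra, and the homeomorphism is natural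
      (∀ (R S : TambaraFunctor.{u, v} H) (φ : R.Hom S),
        ∃ (s : C(NakaokaSpectrum S, NakaokaSpectrum R))
          (t : C(NakaokaSpectrum (S.coind H), NakaokaSpectrum (R.coind H))),
          (∀ q, (s q).ideal = q.ideal.comap φ) ∧
          (∀ q, (t q).ideal = q.ideal.comap (φ.coind H)) ∧
          ∀ q, Ψ R (t q) = s (Ψ S q)) := by
  exact ⟨TambaraIdeal.coindIso, NakaokaSpectrum.coindHomeomorph, fun _ _ _ => rfl,
    fun _ => TambaraIdeal.coind_mul, fun _ _ => TambaraIdeal.isPrime_coind_iff,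
    NakaokaSpectrum.coind_ideal_coindHomeomorph, fun _ _ φ =>
      ⟨NakaokaSpectrum.comap φ, NakaokaSpectrum.comap (φ.coind H), fun _ => rfl, fun _ => rfl,
        NakaokaSpectrum.coindHomeomorph_comap φ⟩⟩
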